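/- Let $p$ be a prime and let $\Bbbk$ be an algebraically closed field of characteristic $p$. The Yangian $Y_2$ of $\mathfrak{gl}_2$ is the associative $\Bbbk$-algebra with generators $t_{i,j}^{(r)}$ ($1\le i,j\le 2$, $r>0$) and relations $$[t_{i,j}^{(r)},t_{k,l}^{(s)}]=\sum_{t=0}^{\min(r,s)-1}\left(t_{k,j}^{(t)}t_{i,l}^{(r+s-1-t)}-t_{k,j}^{(r+s-1-t)}t_{i,l}^{(t)}\right)\qquad(r,s>0),$$ where $t_{i,j}^{(0)}=\delta_{i,j}$. Put $t_{i,j}(u)=\sum_{r\ge0}t_{i,j}^{(r)}u^{-r}$. Tensor products of $Y_2$-modules are formed with the comultiplication $\Delta(t_{i,j}(u))=\sum_{k=1}^{2}t_{i,k}(u)\otimes t_{k,j}(u)$; the empty tensor product is the trivial module $\Bbbk$, on which $t_{i,j}(u)$ acts as $\delta_{i,j}$. For $n\in\mathbb F_p$ let $[n]\in\{0,1,\dots,p-1\}$ be its least non-negative representative. For $\alpha,\beta\in\mathbb F_p$ let $L(\alpha,\beta)$ be the irreducible module over the restricted enveloping algebra $U_0(\mathfrak{gl}_2)$ generated by a vector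 $\xi$ with $e_{1,1}\xi=\alpha\xi$, $e_{2,2}\xi=\beta\xi$, $e_{1,2}\xi=0$; it has basis $e_{2,1}^m\xi$, $0\le m\le[\alpha-\beta]$. It is regarded as a $Y_2$-module through the evaluation homomorphism $t_{i,j}(u)\mapsto\delta_{i,j}+e_{i,j}u^{-1}$. Let $k\ge0$ and let $\alpha_1,\dots,\alpha_k$ and $\beta_1,\dots,\beta_k$ be two sequences of elements of $\mathbb F_p$. Then the two sequences can be renumbered (each by its own permutation) in such a way that for every $i$ the number $[\alpha_i-\beta_i]$ is minimal among all $[\alpha_j-\beta_l]$ with $i\le j,l\le k$; and for every such renumbering the tensor product $$L(\alpha_1,\beta_1)\otimes\cdots\otimes L(\alpha_k,\beta_k)$$ is an irreducible $Y_2$-module. -/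

import Mathlib

open scoped TensorProduct

universe u

namespace ModularYangian

/-- A family `x i j r` (`i, j ∈ {1,2}`, `r ≥ 0`) of elements of a ring with `x i j 0 = δ_{ij}`
which satisfies the RTT relations of the Yangian of `𝔤𝔩₂`. -/
structure RTT {A : Type u} [Ring A] (x : Fin 2 → Fin 2 → ℕ → A) : Prop where
  zero : ∀ i j, x i j 0 = if i = j then 1 else 0
  rel : ∀ i j k l r s, 0 < r → 0 < s →
    x i j r * x k l s - x k l s * x i j r =
      ∑ t ∈ Finset.range (min r s),
        (x k j t * x i l (r + s - 1 - t) - x k j (r + s - 1 - t) * x i l t)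

/-- The symbol `t_{ij}^{(r)}` in the free algebra on the generators `t_{ij}^{(r)}`, `r > 0`, where
the generator `t_{ij}^{(r+1)}` is indexed by `(i, j, r)`; by convention `t_{ij}^{(0)} = δ_{ij}`. -/
def tFree (𝕜 : Type u) [Field 𝕜] (i j : Fin 2) : ℕ → FreeAlgebra 𝕜 (Fin 2 × Fin 2 × ℕ)
  | 0 => if i = j then 1 else 0
  | r + 1 => FreeAlgebra.ι 𝕜 (i, j, r)

/-- The RTT relations. -/
inductive YangianRel (𝕜 : Type u) [Field 𝕜] :
    FreeAlgebra 𝕜 (Fin 2 × Fin 2 × ℕ) → FreeAlgebra 𝕜 (Fin 2 × Fin 2 × ℕ) → Prop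
  | rtt (i j k l : Fin 2) (r s : ℕ) (hr : 0 < r) (hs : 0 < s) :
      YangianRel 𝕜 (tFree 𝕜 i j r * tFree 𝕜 k l s - tFree 𝕜 k l s * tFree 𝕜 i j r)
        (∑ t ∈ Finset.range (min r s),
          (tFree 𝕜 k j t * tFree 𝕜 i l (r + s - 1 - t)
            - tFree 𝕜 k j (r + s - 1 - t) * tFree 𝕜 i l t))

/-- The Yangian `Y₂` of `𝔤𝔩₂` over `𝕜`. -/
def Yangian (𝕜 : Type u) [Field 𝕜] : Type u := RingQuot (YangianRel 𝕜)

instance (𝕜 : Type u) [Field 𝕜] : Ring (Yangian 𝕜) :=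
  inferInstanceAs (Ring (RingQuot (YangianRel 𝕜)))

instance (𝕜 : Type u) [Field 𝕜] : Algebra 𝕜 (Yangian 𝕜) :=
  inferInstanceAs (Algebra 𝕜 (RingQuot (YangianRel 𝕜)))

/-- The quotient map from the free algebra. -/
def yangianMk (𝕜 : Type u) [Field 𝕜] : FreeAlgebra 𝕜 (Fin 2 × Fin 2 × ℕ) →ₐ[𝕜] Yangian 𝕜 :=
  RingQuot.mkAlgHom 𝕜 (YangianRel 𝕜)

/-- The element `t_{ij}^{(r)}` of `Y₂`. -/
def yt (𝕜 : Type u) [Field 𝕜] (i j : Fin 2) (r : ℕ) : Yangian 𝕜 :=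
  yangianMk 𝕜 (tFree 𝕜 i j r)

theorem rtt_yt (𝕜 : Type u) [Field 𝕜] : RTT (yt 𝕜) where
  zero i j := by
    unfold yt tFree
    split_ifs <;> simp
  rel i j k l r s hr hs := by
    have h : yangianMk 𝕜 _ = yangianMk 𝕜 _ :=
      RingQuot.mkAlgHom_rel 𝕜 (YangianRel.rtt (𝕜 := 𝕜) i j k l r s hr hs)
    simpa [yt, map_sum] using h

theorem RTT.map {𝕜 : Type u} [Field 𝕜] {A B : Type u} [Ring A] [Ring B] [Algebra 𝕜 A] [Algebra 𝕜 B]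
    {x : Fin 2 → Fin 2 → ℕ → A} (hx : RTT x) (φ : A →ₐ[𝕜] B) : RTT (fun i j r => φ (x i j r)) where
  zero i j := by rw [hx.zero]; split_ifs <;> simp
  rel i j k l r s hr hs := by
    simpa [map_sum] using congrArg φ (hx.rel i j k l r s hr hs)

/-- The algebra homomorphism out of `Y₂` with prescribed values on the generators. -/
def yangianLift {𝕜 : Type u} [Field 𝕜] {A : Type u} [Ring A] [Algebra 𝕜 A]
    (x : Fin 2 → Fin 2 → ℕ → A) (hx : RTT x) : Yangian 𝕜 →ₐ[𝕜] A :=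
  RingQuot.liftAlgHom 𝕜
    ⟨FreeAlgebra.lift 𝕜 (fun g : Fin 2 × Fin 2 × ℕ => x g.1 g.2.1 (g.2.2 + 1)), by
      have key : ∀ i j r, FreeAlgebra.lift 𝕜
          (fun g : Fin 2 × Fin 2 × ℕ => x g.1 g.2.1 (g.2.2 + 1)) (tFree 𝕜 i j r) = x i j r := by
        intro i j r
        cases r with
        | zero => rw [hx.zero]; unfold tFree; split_ifs <;> simp
        | succ r => simp [tFree]
      rintro _ _ ⟨i, j, k, l, r, s, hr, hs⟩
      simpa [map_sum, key] using hx.rel i j k l r s hr hs⟩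

theorem yangianLift_yt {𝕜 : Type u} [Field 𝕜] {A : Type u} [Ring A] [Algebra 𝕜 A]
    (x : Fin 2 → Fin 2 → ℕ → A) (hx : RTT x) (i j : Fin 2) (r : ℕ) :
    yangianLift (𝕜 := 𝕜) x hx (yt 𝕜 i j r) = x i j r := by
  refine (RingQuot.liftAlgHom_mkAlgHom_apply 𝕜 _ _ _).trans ?_
  cases r with
  | zero => rw [hx.zero]; unfold tFree; split_ifs <;> simp
  | succ r => simp [tFree]

/-! ### The comultiplication -/

/-- The recursive form of the RTT relations, i.e. the relation
`(u - v) [t_{ij}(u), t_{kl}(v)] = t_{kj}(u) t_{il}(v) - t_{kj}(v) t_{il}(u)`. -/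
theorem rtt_iff {A : Type u} [Ring A] (x : Fin 2 → Fin 2 → ℕ → A) :
    RTT x ↔ (∀ i j, x i j 0 = if i = j then 1 else 0) ∧ ∀ i j k l r s,
      (x i j (r + 1) * x k l s - x k l s * x i j (r + 1))
        - (x i j r * x k l (s + 1) - x k l (s + 1) * x i j r)
      = x k j r * x i l s - x k j s * x i l r := by
  have F : ∀ i j k l r s,
      (∑ t ∈ Finset.range (min (r + 1) s),
        (x k j t * x i l (r + 1 + s - 1 - t) - x k j (r + 1 + s - 1 - t) * x i l t))
      - (∑ t ∈ Finset.range (min r (s + 1)),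
        (x k j t * x i l (r + (s + 1) - 1 - t) - x k j (r + (s + 1) - 1 - t) * x i l t))
      = x k j r * x i l s - x k j s * x i l r := by
    intro i j k l r s
    have e1 : r + 1 + s - 1 = r + s := by omega
    have e2 : r + (s + 1) - 1 = r + s := by omega
    rw [e1, e2]
    rcases lt_trichotomy r s with h | h | h
    · rw [min_eq_left (by omega : r + 1 ≤ s), min_eq_left (by omega : r ≤ s + 1),
        Finset.sum_range_succ, show r + s - r = s by omega]
      abel
    · subst h
      rw [min_eq_right (by omega : r ≤ r + 1), min_eq_left (by omega : r ≤ r + 1)]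
      abel
    · rw [min_eq_right (by omega : s ≤ r + 1), min_eq_right (by omega : s + 1 ≤ r),
        Finset.sum_range_succ, show r + s - s = r by omega]
      abel
  constructor
  · rintro ⟨h0, h⟩
    have h' : ∀ i j k l r s, x i j r * x k l s - x k l s * x i j r =
        ∑ t ∈ Finset.range (min r s),
          (x k j t * x i l (r + s - 1 - t) - x k j (r + s - 1 - t) * x i l t) := by
      intro i j k l r s
      rcases Nat.eq_zero_or_pos r with rfl | hr
      · rw [h0]; split_ifs <;> simp
      rcases Nat.eq_zero_or_pos s with rfl | hs
      · rw [h0]; split_ifs <;> simp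
      exact h i j k l r s hr hs
    refine ⟨h0, fun i j k l r s => ?_⟩
    rw [h', h', F]
  · rintro ⟨h0, h⟩
    refine ⟨h0, fun i j k l r s _ _ => ?_⟩
    clear * - h h0 F
    induction r generalizing s with
    | zero => rw [h0]; split_ifs <;> simp
    | succ r ih =>
      have h1 := h i j k l r s
      rw [ih (s + 1), ← F i j k l r s] at h1
      exact sub_left_injective h1

open PowerSeries in
/-- The relation of `rtt_iff` between formal power series in `u⁻¹` (inner variable) and `v⁻¹`
(outer variable). -/
theorem rtt_series {A : Type u} [Ring A] (x : Fin 2 → Fin 2 → ℕ → A)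
    (hx : ∀ i j, x i j 0 = if i = j then 1 else 0) :
    RTT x ↔ ∀ i j k l,
      ((X : PowerSeries (PowerSeries A)) - C X) *
        (C (mk (x i j)) * mk (fun s => C (x k l s)) - mk (fun s => C (x k l s)) * C (mk (x i j)))
      = (X * C X) *
        (C (mk (x k j)) * mk (fun s => C (x i l s))
          - mk (fun s => C (x k j s)) * C (mk (x i l))) := by
  have hc : ∀ i j k l, x i j 0 * x k l 0 = x k l 0 * x i j 0 := by
    intro i j k l; rw [hx i j]; split_ifs <;> simp
  have hc1 : ∀ i j k l r, x i j 0 * x k l r = x k l r * x i j 0 := by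
    intro i j k l r; rw [hx i j]; split_ifs <;> simp
  rw [rtt_iff]
  constructor
  · rintro ⟨-, h⟩ i j k l
    ext s r
    rw [sub_mul, mul_assoc]
    cases s with
    | zero =>
      cases r with
      | zero => simp
      | succ r => simp [coeff_succ_X_mul, hc1]
    | succ s =>
      cases r with
      | zero => simp [coeff_succ_X_mul, hc1]
      | succ r => simpa [coeff_succ_X_mul] using h i j k l r s
  · intro h
    refine ⟨hx, fun i j k l r s => ?_⟩
    have := congrArg (fun z => coeff (r + 1) (coeff (s + 1) z)) (h i j k l)
    rw [sub_mul, mul_assoc] at this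
    simpa [coeff_succ_X_mul] using this

theorem rtt_mul_aux {P : Type u} [Ring P] (d q : P) (hd : ∀ z, d * z = z * d)
    (hq : ∀ z, q * z = z * q) (a a' b b' : Fin 2 → Fin 2 → P)
    (ha : ∀ i j k l, d * (a i j * a' k l - a' k l * a i j) = q * (a k j * a' i l - a' k j * a i l))
    (hb : ∀ i j k l, d * (b i j * b' k l - b' k l * b i j) = q * (b k j * b' i l - b' k j * b i l))
    (c2 : ∀ i j k l, b i j * a' k l = a' k l * b i j)
    (c3 : ∀ i j k l, b' i j * a k l = a k l * b' i j) (i j k l : Fin 2) :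
    d * ((∑ m, a i m * b m j) * (∑ n, a' k n * b' n l)
        - (∑ n, a' k n * b' n l) * (∑ m, a i m * b m j))
      = q * ((∑ m, a k m * b m j) * (∑ n, a' i n * b' n l)
        - (∑ m, a' k m * b' m j) * (∑ n, a i n * b n l)) := by
  have key : ∀ m n, d * ((a i m * b m j) * (a' k n * b' n l) - (a' k n * b' n l) * (a i m * b m j))
      = q * ((a k m * b m j) * (a' i n * b' n l)) - q * (a' k m * a i n * (b m j * b' n l))
        + (q * (a' k n * a i m * (b n j * b' m l)) - q * ((a' k n * b' n j) * (a i m * b m l))) := by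
    intro m n
    have e1 : (a i m * b m j) * (a' k n * b' n l) = a i m * a' k n * (b m j * b' n l) := by
      rw [mul_assoc, ← mul_assoc (b m j), c2]; simp [mul_assoc]
    have e2 : (a' k n * b' n l) * (a i m * b m j) = a' k n * a i m * (b' n l * b m j) := by
      rw [mul_assoc, ← mul_assoc (b' n l), c3]; simp [mul_assoc]
    have e3 : (a k m * b m j) * (a' i n * b' n l) = a k m * a' i n * (b m j * b' n l) := by
      rw [mul_assoc, ← mul_assoc (b m j), c2]; simp [mul_assoc]
    have e4 : (a' k n * b' n j) * (a i m * b m l) = a' k n * a i m * (b' n j * b m l) := by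
      rw [mul_assoc, ← mul_assoc (b' n j), c3]; simp [mul_assoc]
    rw [e1, e2, e3, e4]
    have s1 : d * (a i m * a' k n * (b m j * b' n l) - a' k n * a i m * (b' n l * b m j))
        = (d * (a i m * a' k n - a' k n * a i m)) * (b m j * b' n l)
          + a' k n * a i m * (d * (b m j * b' n l - b' n l * b m j)) := by
      rw [← mul_assoc (a' k n * a i m) d, ← hd (a' k n * a i m)]
      noncomm_ring
    rw [s1, ha, hb, ← mul_assoc (a' k n * a i m) q, ← hq (a' k n * a i m)]
    noncomm_ring
  simp only [Fin.sum_univ_two]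
  have k00 := key 0 0
  have k01 := key 0 1
  have k10 := key 1 0
  have k11 := key 1 1
  have : d * ((a i 0 * b 0 j + a i 1 * b 1 j) * (a' k 0 * b' 0 l + a' k 1 * b' 1 l)
        - (a' k 0 * b' 0 l + a' k 1 * b' 1 l) * (a i 0 * b 0 j + a i 1 * b 1 j))
      = d * ((a i 0 * b 0 j) * (a' k 0 * b' 0 l) - (a' k 0 * b' 0 l) * (a i 0 * b 0 j))
      + d * ((a i 0 * b 0 j) * (a' k 1 * b' 1 l) - (a' k 1 * b' 1 l) * (a i 0 * b 0 j))
      + d * ((a i 1 * b 1 j) * (a' k 0 * b' 0 l) - (a' k 0 * b' 0 l) * (a i 1 * b 1 j))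
      + d * ((a i 1 * b 1 j) * (a' k 1 * b' 1 l) - (a' k 1 * b' 1 l) * (a i 1 * b 1 j)) := by
    noncomm_ring
  rw [this, k00, k01, k10, k11]
  noncomm_ring

/-- If the entries of two RTT families commute with each other, then the coefficients of the
matrix product of the generating series form an RTT family. -/
theorem rtt_mul {A : Type u} [Ring A] (x y : Fin 2 → Fin 2 → ℕ → A) (hx : RTT x) (hy : RTT y)
    (hxy : ∀ i j r k l s, y k l s * x i j r = x i j r * y k l s) :
    RTT (fun i j r => ∑ k, ∑ m ∈ Finset.HasAntidiagonal.antidiagonal r, x i k m.1 * y k j m.2) := by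
  have h0 : ∀ i j : Fin 2, (∑ k, ∑ m ∈ Finset.HasAntidiagonal.antidiagonal 0, x i k m.1 * y k j m.2)
      = if i = j then 1 else 0 := by
    intro i j
    simp [hx.zero, hy.zero]
  rw [rtt_series _ h0]
  intro i j k l
  have hx' := (rtt_series x hx.zero).1 hx
  have hy' := (rtt_series y hy.zero).1 hy
  have e1 : ∀ i j : Fin 2, (PowerSeries.C (PowerSeries.mk
      (fun r => ∑ k, ∑ m ∈ Finset.HasAntidiagonal.antidiagonal r, x i k m.1 * y k j m.2)) :
        PowerSeries (PowerSeries A))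
      = ∑ k, PowerSeries.C (PowerSeries.mk (x i k)) * PowerSeries.C (PowerSeries.mk (y k j)) := by
    intro i j
    simp only [← map_mul, ← map_sum]
    congr 1
    ext r
    simp [PowerSeries.coeff_mul]
  have e2 : ∀ i j : Fin 2, (PowerSeries.mk (fun s => PowerSeries.C
      (∑ k, ∑ m ∈ Finset.HasAntidiagonal.antidiagonal s, x i k m.1 * y k j m.2)) :
        PowerSeries (PowerSeries A))
      = ∑ k, PowerSeries.mk (fun s => PowerSeries.C (x i k s))
          * PowerSeries.mk (fun s => PowerSeries.C (y k j s)) := by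
    intro i j
    ext1 r
    simp [PowerSeries.coeff_mul]
  simp only [e1, e2]
  have hC : ∀ z : PowerSeries (PowerSeries A),
      PowerSeries.C PowerSeries.X * z = z * PowerSeries.C PowerSeries.X := by
    intro z
    ext1 s
    simp [(PowerSeries.commute_X (PowerSeries.coeff s z)).eq]
  refine rtt_mul_aux _ _ ?_ ?_ (fun i j => PowerSeries.C (PowerSeries.mk (x i j)))
    (fun i j => PowerSeries.mk (fun s => PowerSeries.C (x i j s)))
    (fun i j => PowerSeries.C (PowerSeries.mk (y i j)))
    (fun i j => PowerSeries.mk (fun s => PowerSeries.C (y i j s))) hx' hy' ?_ ?_ i j k l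
  · intro z
    rw [sub_mul, mul_sub, (PowerSeries.commute_X z).eq, hC]
  · intro z
    rw [mul_assoc, hC, ← mul_assoc, ← (PowerSeries.commute_X z).eq, mul_assoc]
  · intro i j k l
    ext s r
    simp [hxy]
  · intro i j k l
    ext s r
    simp [hxy]

theorem rtt_left (𝕜 : Type u) [Field 𝕜] :
    RTT (fun i j r => yt 𝕜 i j r ⊗ₜ[𝕜] (1 : Yangian 𝕜)) := by
  have h := (rtt_yt 𝕜).map
    (Algebra.TensorProduct.includeLeft : Yangian 𝕜 →ₐ[𝕜] Yangian 𝕜 ⊗[𝕜] Yangian 𝕜)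
  exact h

theorem rtt_right (𝕜 : Type u) [Field 𝕜] :
    RTT (fun i j r => (1 : Yangian 𝕜) ⊗ₜ[𝕜] yt 𝕜 i j r) := by
  have h := (rtt_yt 𝕜).map
    (Algebra.TensorProduct.includeRight : Yangian 𝕜 →ₐ[𝕜] Yangian 𝕜 ⊗[𝕜] Yangian 𝕜)
  exact h

/-- The comultiplication `Δ(t_{ij}(u)) = ∑ₖ t_{ik}(u) ⊗ t_{kj}(u)`. -/
noncomputable def comul (𝕜 : Type u) [Field 𝕜] :
    Yangian 𝕜 →ₐ[𝕜] Yangian 𝕜 ⊗[𝕜] Yangian 𝕜 :=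
  yangianLift (fun i j r => ∑ k, ∑ m ∈ Finset.HasAntidiagonal.antidiagonal r,
      (yt 𝕜 i k m.1 ⊗ₜ[𝕜] 1) * (1 ⊗ₜ[𝕜] yt 𝕜 k j m.2))
    (rtt_mul _ _ (rtt_left 𝕜) (rtt_right 𝕜) (fun i j r k l s => by simp))

theorem comul_yt (𝕜 : Type u) [Field 𝕜] (i j : Fin 2) (r : ℕ) :
    comul 𝕜 (yt 𝕜 i j r) = ∑ k, ∑ m ∈ Finset.HasAntidiagonal.antidiagonal r,
      yt 𝕜 i k m.1 ⊗ₜ[𝕜] yt 𝕜 k j m.2 := by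
  simp [comul, yangianLift_yt]

/-- The counit `ε(t_{ij}(u)) = δ_{ij}`. -/
def counit (𝕜 : Type u) [Field 𝕜] : Yangian 𝕜 →ₐ[𝕜] 𝕜 :=
  yangianLift (fun i j r => if r = 0 then (if i = j then 1 else 0) else 0)
    { zero := by simp
      rel := by
        intro i j k l r s hr hs
        rw [Finset.sum_eq_zero]
        · simp [hr.ne', hs.ne']
        · intro t ht
          have := Finset.mem_range.1 ht
          have : r + s - 1 - t ≠ 0 := by omega
          simp [this] }

/-! ### Representations of the Yangian -/

/-- A representation of `Y₂`, i.e. a vector space on which `Y₂` acts by an algebra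
homomorphism. -/
structure YRep (𝕜 : Type u) [Field 𝕜] where
  V : Type u
  [addCommGroup : AddCommGroup V]
  [module : Module 𝕜 V]
  act : Yangian 𝕜 →ₐ[𝕜] Module.End 𝕜 V

attribute [instance] YRep.addCommGroup YRep.module

/-- The underlying `Y₂`-module of a representation. -/
instance YRep.yangianModule {𝕜 : Type u} [Field 𝕜] (M : YRep 𝕜) : Module (Yangian 𝕜) M.V :=
  Module.compHom M.V M.act.toRingHom

/-- The trivial one-dimensional representation. -/
def YRep.trivial (𝕜 : Type u) [Field 𝕜] : YRep 𝕜 where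
  V := 𝕜
  act := (Algebra.lmul 𝕜 𝕜).comp (counit 𝕜)

/-- The tensor product of two representations, with `x · (a ⊗ b) = Δ(x) (a ⊗ b)`. -/
noncomputable def YRep.tensor {𝕜 : Type u} [Field 𝕜] (M N : YRep 𝕜) : YRep 𝕜 where
  V := M.V ⊗[𝕜] N.V
  act := (Module.endTensorEndAlgHom (R := 𝕜) (S := 𝕜) (A := 𝕜) (M := M.V) (N := N.V)).comp
    ((Algebra.TensorProduct.map M.act N.act).comp (comul 𝕜))

/-- The tensor product `M₁ ⊗ (M₂ ⊗ (⋯ ⊗ (M_k ⊗ 𝕜)))` of finitely many representations. -/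
noncomputable def YRep.tensorFamily {𝕜 : Type u} [Field 𝕜] : (k : ℕ) → (Fin k → YRep 𝕜) → YRep 𝕜
  | 0, _ => YRep.trivial 𝕜
  | k + 1, M => (M 0).tensor (YRep.tensorFamily k fun i => M i.succ)

/-! ### Evaluation modules -/

attribute [local instance 100] LieRing.ofAssociativeRing

/-- The Lie algebra `𝔤𝔩₂`. -/
abbrev GL2 (𝕜 : Type u) [Field 𝕜] : Type u := Matrix (Fin 2) (Fin 2) 𝕜

/-- The evaluation homomorphism `Y₂ → U(𝔤𝔩₂)`, `t_{ij}(u) ↦ δ_{ij} + e_{ij} u⁻¹`. -/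
noncomputable def ev (𝕜 : Type u) [Field 𝕜] :
    Yangian 𝕜 →ₐ[𝕜] UniversalEnvelopingAlgebra 𝕜 (GL2 𝕜) :=
  yangianLift (fun i j r =>
      if r = 0 then (if i = j then 1 else 0)
      else if r = 1 then UniversalEnvelopingAlgebra.ι 𝕜 (Matrix.single i j (1 : 𝕜) : GL2 𝕜)
      else 0)
    { zero := by simp
      rel := by
        intro i j k l r s hr hs
        by_cases h : r = 1 ∧ s = 1
        · obtain ⟨rfl, rfl⟩ := h
          have hL := (UniversalEnvelopingAlgebra.ι 𝕜 (L := GL2 𝕜)).map_lie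
            (Matrix.single i j 1) (Matrix.single k l 1)
          rw [LieRing.of_associative_ring_bracket, LieRing.of_associative_ring_bracket] at hL
          simp only [one_ne_zero, if_false, if_true, min_self, Finset.sum_range_one]
          rw [← hL, map_sub]
          congr 1
          · by_cases h : k = j
            · subst h; simp
            · simp [h, Matrix.single_mul_single_of_ne, Ne.symm h]
          · by_cases h : i = l
            · subst h; simp
            · simp [h, Matrix.single_mul_single_of_ne, Ne.symm h]
        · have hz : ∀ t, t < min r s → 2 ≤ r + s - 1 - t := by omega
          rw [Finset.sum_eq_zero]
          · have : ¬ (r = 1) ∨ ¬ (s = 1) := by tauto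
            rcases this with h | h <;> simp [h, hr.ne', hs.ne']
          · intro t ht
            have := hz t (Finset.mem_range.1 ht)
            have h0 : r + s - 1 - t ≠ 0 := by omega
            have h1 : r + s - 1 - t ≠ 1 := by omega
            simp [h0, h1] }

/-- A representation of `𝔤𝔩₂` regarded as a representation of `Y₂` through `ev`. -/
noncomputable def evalRep {𝕜 : Type u} [Field 𝕜] (V : Type u) [AddCommGroup V] [Module 𝕜 V]
    (ρ : GL2 𝕜 →ₗ⁅𝕜⁆ Module.End 𝕜 V) : YRep 𝕜 where
  V := V
  act := (UniversalEnvelopingAlgebra.lift 𝕜 ρ).comp (ev 𝕜)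

/-- The operators `e_{ij}` on the vector space with basis `ξ, e₂₁ξ, …, e₂₁ⁿξ` (in coordinates):
`e₂₁ · e₂₁ᵏξ = e₂₁ᵏ⁺¹ξ`, where `e₂₁ⁿ⁺¹ξ = 0`, `e₁₁ · e₂₁ᵏξ = (a - k) e₂₁ᵏξ`,
`e₂₂ · e₂₁ᵏξ = (b + k) e₂₁ᵏξ` and `e₁₂ · e₂₁ᵏξ = k (a - b - k + 1) e₂₁ᵏ⁻¹ξ`. -/
def hwOp {𝕜 : Type u} [Field 𝕜] (n : ℕ) (a b : 𝕜) (i j : Fin 2) :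
    (Fin (n + 1) → 𝕜) →ₗ[𝕜] (Fin (n + 1) → 𝕜) where
  toFun f k := match i, j with
    | 0, 0 => (a - (k : ℕ)) * f k
    | 1, 1 => (b + (k : ℕ)) * f k
    | 0, 1 => if h : (k : ℕ) + 1 < n + 1 then ((k : ℕ) + 1) * (a - b - (k : ℕ)) * f ⟨k + 1, h⟩ else 0
    | 1, 0 => if (k : ℕ) = 0 then 0 else f ⟨(k : ℕ) - 1, by omega⟩
  map_add' f g := by
    ext k
    fin_cases i <;> fin_cases j <;> simp only [Pi.add_apply] <;> (try split_ifs) <;> (try simp) <;> ring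
  map_smul' c f := by
    ext k
    fin_cases i <;> fin_cases j <;> simp only [Pi.smul_apply] <;> (try split_ifs) <;> (try simp) <;> ring

theorem hwOp_comm {𝕜 : Type u} [Field 𝕜] (n : ℕ) (a b : 𝕜) (h : a - b = n) (i j k l : Fin 2) :
    hwOp n a b i j * hwOp n a b k l - hwOp n a b k l * hwOp n a b i j
      = (if j = k then hwOp n a b i l else 0) - (if l = i then hwOp n a b k j else 0) := by
  refine LinearMap.ext fun f => funext fun ⟨m, hm⟩ => ?_
  have hA : m < n ∨ m = n := by omega
  fin_cases i <;> fin_cases j <;> fin_cases k <;> fin_cases l <;>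
    simp [hwOp]
  all_goals
    rcases m with _ | m <;> rcases hA with hA | hA
  all_goals
    try have hB : m < n := by omega
    try have hC : (m : 𝕜) + 1 = a - b := by rw [h, ← hA]; simp
    try have hD : a - b = 0 := by rw [h, ← hA]; simp
    simp [*]
    try ring_nf
    try grind

/-- The representation of `𝔤𝔩₂` with `e_{ij}` acting by `hwOp`, where `n = a - b` in `𝕜`. -/
def hwRep {𝕜 : Type u} [Field 𝕜] (n : ℕ) (a b : 𝕜) (h : a - b = n) :
    GL2 𝕜 →ₗ⁅𝕜⁆ Module.End 𝕜 (Fin (n + 1) → 𝕜) where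
  toFun X := ∑ i, ∑ j, X i j • hwOp n a b i j
  map_add' X Y := by simp [add_smul]; abel
  map_smul' c X := by simp [mul_smul]
  map_lie' := by
    intro X Y
    have c := hwOp_comm n a b h
    have e : ∀ i j k l, hwOp n a b i j * hwOp n a b k l = hwOp n a b k l * hwOp n a b i j +
        ((if j = k then hwOp n a b i l else 0) - (if l = i then hwOp n a b k j else 0)) :=
      fun i j k l => by rw [← c]; abel
    simp only [LieRing.of_associative_ring_bracket, Fin.sum_univ_two, Matrix.sub_apply,
      Matrix.mul_apply, add_mul, mul_add, smul_mul_smul_comm]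
    rw [e 0 1 0 0, e 1 0 0 0, e 1 1 0 0, e 1 0 0 1, e 1 1 0 1, e 1 1 1 0]
    simp
    module

theorem val_sub_cast {p : ℕ} [Fact p.Prime] {𝕜 : Type u} [Field 𝕜] [CharP 𝕜 p] (α β : ZMod p) :
    ZMod.castHom (dvd_refl p) 𝕜 α - ZMod.castHom (dvd_refl p) 𝕜 β = ((α - β).val : 𝕜) := by
  rw [← map_sub, ZMod.castHom_apply, ZMod.natCast_val]

/-- The evaluation module `L(α, β)`, for `α, β ∈ 𝔽_p`: the irreducible restricted `𝔤𝔩₂`-module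
with a vector `ξ` such that `e₁₁ ξ = α ξ`, `e₂₂ ξ = β ξ`, `e₁₂ ξ = 0` and with basis `e₂₁ᵏ ξ`,
`0 ≤ k ≤ [α - β]`, regarded as a `Y₂`-module through the evaluation homomorphism. Here
`[m] = m.val` is the least natural number representing `m ∈ 𝔽_p`. -/
noncomputable def evalModule {p : ℕ} [Fact p.Prime] (𝕜 : Type u) [Field 𝕜] [CharP 𝕜 p]
    (α β : ZMod p) : YRep 𝕜 :=
  evalRep (Fin ((α - β).val + 1) → 𝕜)
    (hwRep (α - β).val (ZMod.castHom (dvd_refl p) 𝕜 α) (ZMod.castHom (dvd_refl p) 𝕜 β)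
      (val_sub_cast α β))

/-- The condition on the order of `(α₁, …, α_k)`, `(β₁, …, β_k)`: for every `i`, the number
`[α_i - β_i]` is minimal among all `[α_j - β_l]` with `j, l ≥ i`. -/
def WellOrdered {p k : ℕ} (α β : Fin k → ZMod p) : Prop :=
  ∀ i j l, i ≤ j → i ≤ l → (α i - β i).val ≤ (α j - β l).val

end ModularYangian

/-! Irreducibility is reduced to two uniqueness statements. Suppose that up to scalars `z` is the
only vector killed by every coefficient of `t₁₂(u)`, that up to scalars `f` is the only functional
killed by the transposes of all coefficients of `t₂₁(u)`, and that `f z ≠ 0`. If `t₁₂(u)` and the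
transpose of `t₂₁(u)` lower finite filtrations, a nonzero submodule contains `z`, while the
annihilator of a proper submodule contains `f`. A nonzero proper submodule would thus give `f z = 0`
(`YRep.isSimpleModule_of_hasUniqueSingular`).

Both uniqueness statements go by induction on the number of tensor factors, peeling off the first
one. The formulas `Δ(t₁₂) = t₁₁ ⊗ t₁₂ + t₁₂ ⊗ t₂₂` and `Δ(t₂₂) = t₂₁ ⊗ t₁₂ + t₂₂ ⊗ t₂₂` involve only
`t₁₂`, `t₂₂` of the remaining factors. In the same way the transposes of `t₂₁`, `t₁₁` form a closed
pair, and `HasUniqueSingular.step` treats both at once. It decomposes along the basis `e₂₁ᵐ ξ` of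
the first factor, where a killed vector `x = ∑ e₂₁ᵐ ξ ⊗ xₘ` satisfies `(1 + cₘ u⁻¹) t₁₂(u) xₘ + dₘ
u⁻¹ t₂₂(u) xₘ₊₁ = 0`. If `xₘ₊₁` is already known to be `a • z`, clearing denominators and putting `u
= -cₘ` gives `dₘ a ∏ⱼ (-cₘ + δⱼ) = 0`.

The ordering condition ensures that the needed factors do not vanish: for `m < [α₁ - β₁]` neither
`α₁ - βⱼ` nor `αⱼ - β₁` equals `m` in the field. -/

namespace ModularYangian

/-! ### Operator pairs with a unique singular vector -/

section Abstract

variable {𝕜 : Type u} [Field 𝕜]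

/-- The coefficients of `∏ⱼ (1 + δⱼ X)`, i.e. the elementary symmetric functions of `δ`. -/
def elemSymm : (k : ℕ) → (Fin k → 𝕜) → ℕ → 𝕜
  | 0, _, 0 => 1
  | 0, _, _ + 1 => 0
  | _ + 1, _, 0 => 1
  | k + 1, δ, r + 1 => elemSymm k (fun i => δ i.succ) (r + 1)
      + δ 0 * elemSymm k (fun i => δ i.succ) r

theorem elemSymm_zero (k : ℕ) (δ : Fin k → 𝕜) : elemSymm k δ 0 = 1 := by
  cases k <;> rfl

theorem elemSymm_of_lt {k : ℕ} (δ : Fin k → 𝕜) {r : ℕ} (h : k < r) : elemSymm k δ r = 0 := by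
  induction k generalizing r with
  | zero => cases r with
    | zero => omega
    | succ r => rfl
  | succ k ih => cases r with
    | zero => omega
    | succ r =>
      rw [elemSymm, ih _ (by omega : k < r + 1), ih _ (by omega : k < r)]
      simp

/-- This is `∏ⱼ (1 + δⱼ u⁻¹)` with denominators cleared by `uᵏ`, so that `u = w` may be any scalar,
including `0`. -/
theorem sum_elemSymm (k : ℕ) (δ : Fin k → 𝕜) (w : 𝕜) :
    ∑ r ∈ Finset.range (k + 1), w ^ (k - r) * elemSymm k δ r = ∏ j, (w + δ j) := by
  induction k with
  | zero => simp [elemSymm_zero]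
  | succ k ih =>
    rw [Fin.prod_univ_succ, ← ih (fun i => δ i.succ), add_mul, Finset.sum_range_succ']
    simp only [elemSymm, mul_add, Finset.sum_add_distrib, Nat.add_sub_add_right]
    rw [Finset.sum_range_succ, elemSymm_of_lt (r := k + 1) _ (by omega), mul_zero, add_zero,
      add_right_comm]
    congr 1
    · rw [Finset.sum_range_succ', mul_add, Finset.mul_sum, elemSymm_zero]
      congr 1
      · refine Finset.sum_congr rfl fun r hr => ?_
        have hr := Finset.mem_range.1 hr
        rw [← mul_assoc, ← pow_succ', show k - (r + 1) + 1 = k - r by omega]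
      · simp [pow_succ']
    · rw [Finset.mul_sum]
      exact Finset.sum_congr rfl fun r _ => by ring

/-- `A` and `B` are the coefficients of two operator-valued polynomials in `u⁻¹` of degree at most
`k`, `A` strictly lowers a finite filtration that `B` preserves, and up to scalars `z` is the only
vector killed by `A`; it is an eigenvector of `B(u)` for the eigenvalue `∏ⱼ (1 + δⱼ u⁻¹)`. -/
structure HasUniqueSingular {V : Type u} [AddCommGroup V] [Module 𝕜 V] (k : ℕ) (δ : Fin k → 𝕜)
    (A B : ℕ → Module.End 𝕜 V) (z : V) : Prop where
  A_zero : A 0 = 0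
  B_zero : B 0 = 1
  A_of_lt : ∀ r, k < r → A r = 0
  B_of_lt : ∀ r, k < r → B r = 0
  ne_zero : z ≠ 0
  A_apply : ∀ r, A r z = 0
  B_apply : ∀ r, B r z = elemSymm k δ r • z
  unique : ∀ x, (∀ r, A r x = 0) → ∃ a : 𝕜, x = a • z
  filtration : ∃ F : ℕ → Submodule 𝕜 V, Monotone F ∧ F 0 = ⊥ ∧ (∃ D, F D = ⊤) ∧
    (∀ d r, ∀ x ∈ F d, A r x ∈ F (d - 1)) ∧ ∀ d r, ∀ x ∈ F d, B r x ∈ F d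

variable {V V' : Type u} [AddCommGroup V] [Module 𝕜 V] [AddCommGroup V'] [Module 𝕜 V']

/-- Keep applying coefficients of `A` to a nonzero vector of `N` as long as some coefficient does
not kill it. Each application lowers the filtration degree, so the process stops, necessarily at a
nonzero multiple of `z`. -/
theorem HasUniqueSingular.mem {k : ℕ} {δ : Fin k → 𝕜} {A B : ℕ → Module.End 𝕜 V} {z : V}
    (h : HasUniqueSingular k δ A B z) (N : Submodule 𝕜 V) (hN : N ≠ ⊥)
    (hA : ∀ r, ∀ x ∈ N, A r x ∈ N) : z ∈ N := by
  obtain ⟨F, -, hF0, ⟨D, hD⟩, hFA, -⟩ := h.filtration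
  obtain ⟨y, hy, hy0⟩ := Submodule.exists_mem_ne_zero_of_ne_bot hN
  have key : ∀ d, ∀ x ∈ F d, x ∈ N → x ≠ 0 → z ∈ N := by
    intro d
    induction d with
    | zero =>
      intro x hx _ hx0
      rw [hF0] at hx
      exact absurd ((Submodule.mem_bot 𝕜).1 hx) hx0
    | succ d ih =>
      intro x hx hxN hx0
      by_cases hs : ∀ r, A r x = 0
      · obtain ⟨a, rfl⟩ := h.unique x hs
        exact (N.smul_mem_iff (left_ne_zero_of_smul hx0)).1 hxN
      · push Not at hs
        obtain ⟨r, hr⟩ := hs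
        exact ih _ (hFA _ r x hx) (hA r x hxN) hr
  exact key D y (hD ▸ Submodule.mem_top) hy hy0

/-- The induction step for one more tensor factor. The maps `π m`, `0 ≤ m ≤ n`, play the role of
coordinates with values in `V`; in them `A'(u)` is `(1 + cₘ u⁻¹) A(u)` on the diagonal plus `dₘ u⁻¹
B(u)` from coordinate `m + 1`, and `B'(u)` has the analogous form with `A(u)` coming from coordinate
`m - 1`. The hypothesis `hδ` says that `-cₘ` is not a root of the eigenvalue polynomial of `B` on
`z`. -/
theorem HasUniqueSingular.step {k : ℕ} {δ : Fin (k + 1) → 𝕜} {A B : ℕ → Module.End 𝕜 V} {z : V}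
    (h : HasUniqueSingular k (fun i => δ i.succ) A B z) {A' B' : ℕ → Module.End 𝕜 V'} {z' : V'}
    (n : ℕ) (c c' d g : ℕ → 𝕜) (π : ℕ → V' →ₗ[𝕜] V)
    (hπ : ∀ x, (∀ m, π m x = 0) → x = 0) (hπn : ∀ m, n < m → π m = 0)
    (hA0 : A' 0 = 0) (hB0 : B' 0 = 1)
    (hA : ∀ m r x, m ≤ n → π m (A' (r + 1) x)
      = A (r + 1) (π m x) + c m • A r (π m x) + d m • B r (π (m + 1) x))
    (hB : ∀ m r x, m ≤ n → π m (B' (r + 1) x)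
      = B (r + 1) (π m x) + c' m • B r (π m x) + g m • A r (π (m - 1) x))
    (hz : π 0 z' = z) (hz' : ∀ m, 0 < m → π m z' = 0)
    (hg : g 0 = 0) (hc' : c' 0 = δ 0) (hd : ∀ m < n, d m ≠ 0)
    (hδ : ∀ m < n, ∀ j : Fin k, -c m + δ j.succ ≠ 0) :
    HasUniqueSingular (k + 1) δ A' B' z' := by
  have ext' : ∀ x y, (∀ m, m ≤ n → π m x = π m y) → x = y := by
    intro x y hxy
    refine sub_eq_zero.1 (hπ _ fun m => ?_)
    rcases le_or_gt m n with hm | hm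
    · rw [map_sub, hxy m hm, sub_self]
    · rw [hπn m hm]; rfl
  -- Once coordinate `m + 1` vanishes, `(1 + cₘ u⁻¹) A(u) xₘ = 0`, and the scalar series is
  -- invertible.
  have killed : ∀ x m, m ≤ n → (∀ r, A' r x = 0) → π (m + 1) x = 0 → ∀ r, A r (π m x) = 0 := by
    intro x m hm hx h0 r
    induction r with
    | zero => rw [h.A_zero]; rfl
    | succ r ih =>
      have := hA m r x hm
      rw [hx, h0, ih] at this
      simpa using this.symm
  refine ⟨hA0, hB0, ?_, ?_, ?_, ?_, ?_, ?_, ?_⟩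
  · rintro (_ | r) hr
    · omega
    refine LinearMap.ext fun x => ext' _ _ fun m hm => ?_
    rw [hA m r x hm, h.A_of_lt _ (by omega), h.A_of_lt _ (by omega), h.B_of_lt _ (by omega)]
    simp
  · rintro (_ | r) hr
    · omega
    refine LinearMap.ext fun x => ext' _ _ fun m hm => ?_
    rw [hB m r x hm, h.B_of_lt _ (by omega), h.B_of_lt _ (by omega), h.A_of_lt _ (by omega)]
    simp
  · rintro rfl
    exact h.ne_zero (by rw [← hz, map_zero])
  · rintro (_ | r)
    · rw [hA0]; rfl
    refine ext' _ _ fun m hm => ?_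
    rw [hA m r _ hm, hz' (m + 1) (by omega)]
    rcases Nat.eq_zero_or_pos m with rfl | hm0
    · simp [hz, h.A_apply]
    · simp [hz' m hm0]
  · rintro (_ | r)
    · rw [hB0, elemSymm_zero, one_smul]; rfl
    refine ext' _ _ fun m hm => ?_
    rw [hB m r _ hm, map_smul]
    rcases Nat.eq_zero_or_pos m with rfl | hm0
    · simp [hz, h.B_apply, hg, hc', elemSymm, add_smul, mul_smul]
    · rw [hz' m hm0]
      rcases Nat.eq_zero_or_pos (m - 1) with h1 | h1
      · simp [h1, hz, h.A_apply]
      · simp [hz' _ h1]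
  · intro x hx
    -- Downward induction on `m`, starting above `n`, shows that all coordinates except the one with
    -- index `0` vanish.
    have vanish : ∀ j m, 1 ≤ m → n + 1 ≤ m + j → π m x = 0 := by
      intro j
      induction j with
      | zero => intro m _ hm; rw [hπn m (by omega)]; rfl
      | succ j ih =>
        intro m hm1 hmj
        rcases le_or_gt m n with hm | hm
        swap
        · rw [hπn m hm]; rfl
        obtain ⟨a, ha⟩ := h.unique _ (killed x m hm hx (ih (m + 1) (by omega) (by omega)))
        -- The coordinate known to be `a • z` is now `m + 1`; the equation showing `a = 0` is the
        -- one for coordinate `m`.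
        obtain ⟨m, rfl⟩ : ∃ q, m = q + 1 := ⟨m - 1, by omega⟩
        set w := -c m with hw
        have e1 : ∀ r, A (r + 1) (π m x) - w • A r (π m x)
            = -((d m * a * elemSymm k (fun i => δ i.succ) r) • z) := by
          intro r
          have := hA m r x (by omega)
          rw [hx, map_zero, ha, map_smul, h.B_apply] at this
          rw [eq_neg_iff_add_eq_zero, this, hw]
          module
        -- Evaluation of `uᵏ⁺¹ (1 + cₘ u⁻¹) A(u) xₘ` at its root `u = w`. The sum telescopes, and
        -- the two end terms vanish because `A 0 = 0` and `A (k + 1) = 0`.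
        have e2 : ∑ r ∈ Finset.range (k + 1), w ^ (k - r) •
            (A (r + 1) (π m x) - w • A r (π m x)) = 0 := by
          have := Finset.sum_range_sub (fun r => w ^ (k + 1 - r) • A r (π m x)) (k + 1)
          rw [h.A_of_lt (k + 1) (by omega), h.A_zero] at this
          simp only [LinearMap.zero_apply, smul_zero, sub_self] at this
          rw [← this]
          refine Finset.sum_congr rfl fun r hr => ?_
          have hr := Finset.mem_range.1 hr
          rw [Nat.add_sub_add_right, show k + 1 - r = k - r + 1 by omega, pow_succ, smul_sub,
            smul_smul]
        simp only [e1, smul_neg, smul_smul, Finset.sum_neg_distrib, neg_eq_zero] at e2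
        rw [← Finset.sum_smul] at e2
        have e3 : ∑ r ∈ Finset.range (k + 1),
            w ^ (k - r) * (d m * a * elemSymm k (fun i => δ i.succ) r)
            = d m * a * ∏ j : Fin k, (w + δ j.succ) := by
          rw [← sum_elemSymm, Finset.mul_sum]
          exact Finset.sum_congr rfl fun r _ => by ring
        rw [e3] at e2
        have e4 := (smul_eq_zero.1 e2).resolve_right h.ne_zero
        have e5 : ∏ j : Fin k, (w + δ j.succ) ≠ 0 :=
          Finset.prod_ne_zero_iff.2 fun j _ => hδ m (by omega) j
        have e6 : a = 0 :=
          (mul_eq_zero.1 ((mul_eq_zero.1 e4).resolve_right e5)).resolve_left (hd m (by omega))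
        rw [ha, e6, zero_smul]
    obtain ⟨a, ha⟩ := h.unique _ (killed x 0 (by omega) hx (vanish n 1 le_rfl (by omega)))
    refine ⟨a, ext' _ _ fun m _ => ?_⟩
    rcases Nat.eq_zero_or_pos m with rfl | hm0
    · rw [map_smul, hz, ha]
    · rw [map_smul, hz' m hm0, vanish n m hm0 (by omega), smul_zero]
  · obtain ⟨F, hF, hF0, ⟨D, hD⟩, hFA, hFB⟩ := h.filtration
    -- Coordinate `m` is given extra degree `m`. This absorbs the term `B xₘ₊₁` in `A'`, since `B`
    -- alone does not lower degrees, and leaves room in `B'` for `A xₘ₋₁`.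
    refine ⟨fun e => ⨅ m : ℕ, (F (e - m)).comap (π m), ?_, ?_, ⟨D + n, ?_⟩, ?_, ?_⟩
    · intro e e' hee
      exact iInf_mono fun m => Submodule.comap_mono (hF (by omega))
    · refine (Submodule.eq_bot_iff _).2 fun x hx => hπ x fun m => ?_
      have := (Submodule.mem_iInf _).1 hx m
      simpa [hF0] using this
    · refine (Submodule.eq_top_iff').2 fun x => (Submodule.mem_iInf _).2 fun m => ?_
      rcases le_or_gt m n with hm | hm
      · have : (F D : Submodule 𝕜 V) ≤ F (D + n - m) := hF (by omega)
        exact this (hD ▸ Submodule.mem_top)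
      · rw [hπn m hm]; simp
    · rintro e (_ | r) x hx
      · rw [hA0]; exact Submodule.zero_mem _
      refine (Submodule.mem_iInf _).2 fun m => ?_
      have hx := fun m => (Submodule.mem_iInf _).1 hx m
      simp only [Submodule.mem_comap] at hx ⊢
      rcases le_or_gt m n with hm | hm
      swap
      · rw [hπn m hm]; simp
      rw [hA m r x hm, show e - 1 - m = e - m - 1 by omega]
      refine add_mem (add_mem (hFA _ _ _ (hx m)) (Submodule.smul_mem _ _ (hFA _ _ _ (hx m)))) ?_
      refine Submodule.smul_mem _ _ (hFB _ _ _ ?_)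
      simpa [Nat.sub_sub] using hx (m + 1)
    · rintro e (_ | r) x hx
      · rw [hB0]; exact hx
      refine (Submodule.mem_iInf _).2 fun m => ?_
      have hx := fun m => (Submodule.mem_iInf _).1 hx m
      simp only [Submodule.mem_comap] at hx ⊢
      rcases le_or_gt m n with hm | hm
      swap
      · rw [hπn m hm]; simp
      rw [hB m r x hm]
      refine add_mem (add_mem (hFB _ _ _ (hx m)) (Submodule.smul_mem _ _ (hFB _ _ _ (hx m)))) ?_
      -- At `m = 0` the truncated index `m - 1` is again `0`, and only `g 0 = 0` removes that term.
      rcases Nat.eq_zero_or_pos m with rfl | hm0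
      · rw [hg, zero_smul]; exact Submodule.zero_mem _
      refine Submodule.smul_mem _ _ ?_
      have := hFA _ r _ (hx (m - 1))
      rwa [show e - (m - 1) - 1 = e - m by omega] at this

end Abstract

/-- Greedy choice: move a pair with globally minimal difference to the front and recurse on the
remaining entries. -/
theorem exists_wellOrdered {p k : ℕ} (α β : Fin k → ZMod p) :
    ∃ σ τ : Equiv.Perm (Fin k), WellOrdered (α ∘ σ) (β ∘ τ) := by
  induction k with
  | zero => exact ⟨1, 1, fun i => i.elim0⟩
  | succ k ih =>
    obtain ⟨⟨a, b⟩, hab⟩ := Finite.exists_min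
      fun q : Fin (k + 1) × Fin (k + 1) => (α q.1 - β q.2).val
    obtain ⟨σ, τ, h⟩ := ih (fun i => α (Equiv.swap 0 a i.succ)) (fun i => β (Equiv.swap 0 b i.succ))
    refine ⟨Equiv.Perm.decomposeFin.symm (a, σ), Equiv.Perm.decomposeFin.symm (b, τ), ?_⟩
    intro i j l hij hil
    rcases Fin.eq_zero_or_eq_succ i with rfl | ⟨i, rfl⟩
    · simpa using hab (_, _)
    · obtain ⟨j, rfl⟩ := Fin.exists_succ_eq.2 (Fin.pos_iff_ne_zero.1 (i.succ_pos.trans_le hij))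
      obtain ⟨l, rfl⟩ := Fin.exists_succ_eq.2 (Fin.pos_iff_ne_zero.1 (i.succ_pos.trans_le hil))
      simpa using h i j l (Fin.succ_le_succ_iff.1 hij) (Fin.succ_le_succ_iff.1 hil)

attribute [local instance] LieRing.ofAssociativeRing

/-! ### Operators on tensor products with an evaluation module -/

section Representations

variable {𝕜 : Type u} [Field 𝕜]

/-- The operator by which `t_{ij}^{(r)}` acts on a representation. -/
def YRep.op (M : YRep 𝕜) (i j : Fin 2) (r : ℕ) : Module.End 𝕜 M.V := M.act (yt 𝕜 i j r)

/-- The transpose of the action of `t_{ij}^{(r)}` on a representation. -/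
def YRep.dualOp (M : YRep 𝕜) (i j : Fin 2) (r : ℕ) : Module.End 𝕜 (Module.Dual 𝕜 M.V) :=
  (M.op i j r).dualMap

theorem YRep.dualOp_apply (M : YRep 𝕜) (i j : Fin 2) (r : ℕ) (f : Module.Dual 𝕜 M.V) (x : M.V) :
    M.dualOp i j r f x = f (M.op i j r x) := rfl

theorem YRep.op_zero (M : YRep 𝕜) (i j : Fin 2) : M.op i j 0 = if i = j then 1 else 0 := by
  unfold YRep.op
  rw [(rtt_yt 𝕜).zero]
  split_ifs <;> simp

theorem YRep.op_trivial (i j : Fin 2) (r : ℕ) :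
    (YRep.trivial 𝕜).op i j r = if r = 0 then (if i = j then 1 else 0) else 0 := by
  rcases r with _ | r
  · simp [YRep.op_zero]
  · have : counit 𝕜 (yt 𝕜 i j (r + 1)) = 0 := by simp [counit, yangianLift_yt]
    change (Algebra.lmul 𝕜 𝕜) (counit 𝕜 (yt 𝕜 i j (r + 1))) = _
    rw [this, map_zero, if_neg (by omega)]
    rfl

theorem YRep.op_tensor (M N : YRep 𝕜) (i j : Fin 2) (r : ℕ) (x : M.V) (y : N.V) :
    (M.tensor N).op i j r (x ⊗ₜ[𝕜] y : M.V ⊗[𝕜] N.V) =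
      (∑ k, ∑ m ∈ Finset.HasAntidiagonal.antidiagonal r,
        (M.op i k m.1 x ⊗ₜ[𝕜] N.op k j m.2 y) : M.V ⊗[𝕜] N.V) := by
  change (Module.endTensorEndAlgHom (R := 𝕜) (S := 𝕜) (A := 𝕜) (M := M.V) (N := N.V)
    (Algebra.TensorProduct.map M.act N.act (comul 𝕜 (yt 𝕜 i j r)))) (x ⊗ₜ[𝕜] y) = _
  rw [comul_yt]
  simp only [map_sum, Algebra.TensorProduct.map_tmul, LinearMap.sum_apply,
    Module.endTensorEndAlgHom_apply, TensorProduct.AlgebraTensorModule.map_tmul]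
  rfl

theorem hwRep_single (n : ℕ) (a b : 𝕜) (h : a - b = n) (i j : Fin 2) :
    hwRep n a b h (Matrix.single i j 1) = hwOp n a b i j := by
  change ∑ i', ∑ j', (Matrix.single i j (1 : 𝕜)) i' j' • hwOp n a b i' j' = _
  fin_cases i <;> fin_cases j <;> simp [Fin.sum_univ_two, Matrix.single]

theorem op_evalRep (n : ℕ) (a b : 𝕜) (h : a - b = n) (i j : Fin 2) (r : ℕ) :
    (evalRep (Fin (n + 1) → 𝕜) (hwRep n a b h)).op i j r =
      if r = 0 then (if i = j then 1 else 0) else if r = 1 then hwOp n a b i j else 0 := by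
  change (UniversalEnvelopingAlgebra.lift 𝕜 (hwRep n a b h)) (ev 𝕜 (yt 𝕜 i j r)) = _
  rw [ev, yangianLift_yt]
  split_ifs
  · simp
  · simp
  · rw [UniversalEnvelopingAlgebra.lift_ι_apply, hwRep_single]
  · simp

/-- The tensor product of an evaluation module of `𝔤𝔩₂` with another representation. -/
noncomputable def hwTensor (n : ℕ) (a b : 𝕜) (h : a - b = n) (N : YRep 𝕜) : YRep 𝕜 :=
  (evalRep (Fin (n + 1) → 𝕜) (hwRep n a b h)).tensor N

/-- The map `x ⊗ y ↦ x ⊗ y` into `hwTensor`. -/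
noncomputable def hwTmul (n : ℕ) (a b : 𝕜) (h : a - b = n) (N : YRep 𝕜) :
    (Fin (n + 1) → 𝕜) →ₗ[𝕜] N.V →ₗ[𝕜] (hwTensor n a b h N).V :=
  TensorProduct.mk 𝕜 (Fin (n + 1) → 𝕜) N.V

theorem hwTensor_ext {n : ℕ} {a b : 𝕜} {h : a - b = n} {N : YRep 𝕜} {W : Type u} [AddCommGroup W]
    [Module 𝕜 W] {φ ψ : (hwTensor n a b h N).V →ₗ[𝕜] W}
    (H : ∀ x y, φ (hwTmul n a b h N x y) = ψ (hwTmul n a b h N x y)) : φ = ψ :=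
  TensorProduct.ext' H

theorem op_hwTensor (n : ℕ) (a b : 𝕜) (h : a - b = n) (N : YRep 𝕜) (i j : Fin 2) (r : ℕ)
    (x : Fin (n + 1) → 𝕜) (y : N.V) :
    (hwTensor n a b h N).op i j (r + 1) (hwTmul n a b h N x y) =
      hwTmul n a b h N x (N.op i j (r + 1) y)
        + (hwTmul n a b h N (hwOp n a b i 0 x) (N.op 0 j r y)
          + hwTmul n a b h N (hwOp n a b i 1 x) (N.op 1 j r y)) := by
  have key : ∀ k, ∑ m ∈ Finset.HasAntidiagonal.antidiagonal (r + 1), hwTmul n a b h N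
      ((evalRep (Fin (n + 1) → 𝕜) (hwRep n a b h)).op i k m.1 x) (N.op k j m.2 y)
      = (if i = k then hwTmul n a b h N x (N.op k j (r + 1) y) else 0)
        + hwTmul n a b h N (hwOp n a b i k x) (N.op k j r y) := by
    intro k
    -- The evaluation module has only the coefficients of degree `0` and `1`, so these two terms are
    -- split off and the others vanish.
    rw [Finset.Nat.sum_antidiagonal_eq_sum_range_succ_mk, Finset.sum_range_succ',
      Finset.sum_range_succ', Finset.sum_eq_zero]
    · simp only [op_evalRep]
      by_cases hik : i = k
      · simp only [hik, if_true, zero_add, one_ne_zero, if_false, Nat.sub_zero, Nat.add_sub_cancel]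
        exact add_comm _ _
      · simp only [hik, if_false, if_true, zero_add, one_ne_zero, Nat.sub_zero, Nat.add_sub_cancel]
        refine (congrArg₂ (· + ·) rfl ?_).trans ((add_zero _).trans (zero_add _).symm)
        exact LinearMap.congr_fun (map_zero (hwTmul n a b h N)) _
    · intro s _
      rw [op_evalRep, if_neg (by omega), if_neg (by omega)]
      exact LinearMap.congr_fun (map_zero (hwTmul n a b h N)) _
  refine (YRep.op_tensor (evalRep (Fin (n + 1) → 𝕜) (hwRep n a b h)) N i j (r + 1) x y).trans ?_
  rw [Fin.sum_univ_two]
  refine (congrArg₂ (· + ·) (key 0) (key 1)).trans ?_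
  fin_cases i <;> simp <;> abel

/-! ### Coordinates along the basis of the first factor -/

/-- The coefficient functional of `e₂₁ᵐ ξ`. -/
def hwCoord (n m : ℕ) : (Fin (n + 1) → 𝕜) →ₗ[𝕜] 𝕜 :=
  if h : m < n + 1 then LinearMap.proj ⟨m, h⟩ else 0

/-- The vector `e₂₁ᵐ ξ`. -/
def hwVec (n m : ℕ) : Fin (n + 1) → 𝕜 := fun i => if (i : ℕ) = m then 1 else 0

variable (n : ℕ) (a b : 𝕜) (h : a - b = n) (N : YRep 𝕜)

/-- The component of a vector along `e₂₁ᵐ ξ`. -/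
noncomputable def component (m : ℕ) : (hwTensor n a b h N).V →ₗ[𝕜] N.V :=
  (TensorProduct.lid 𝕜 N.V).toLinearMap ∘ₗ (hwCoord n m).rTensor N.V

/-- The map `y ↦ e₂₁ᵐ ξ ⊗ y`. -/
noncomputable def inclusion (m : ℕ) : N.V →ₗ[𝕜] (hwTensor n a b h N).V :=
  hwTmul n a b h N (hwVec n m)

theorem component_hwTmul (m : ℕ) (x : Fin (n + 1) → 𝕜) (y : N.V) :
    component n a b h N m (hwTmul n a b h N x y) = hwCoord n m x • y := rfl

theorem inclusion_apply (m : ℕ) (y : N.V) :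
    inclusion n a b h N m y = hwTmul n a b h N (hwVec n m) y := rfl

variable {n} in
theorem hwVec_of_lt {m : ℕ} (hm : n < m) : (hwVec n m : Fin (n + 1) → 𝕜) = 0 := by
  funext i
  have : (i : ℕ) ≠ m := by omega
  simp [hwVec, this]

variable {n} in
theorem hwCoord_of_lt {m : ℕ} (hm : n < m) : (hwCoord n m : (Fin (n + 1) → 𝕜) →ₗ[𝕜] 𝕜) = 0 := by
  rw [hwCoord, dif_neg (by omega)]

theorem hwCoord_hwVec_zero (m : ℕ) :
    hwCoord n m (hwVec n 0 : Fin (n + 1) → 𝕜) = if m = 0 then 1 else 0 := by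
  unfold hwCoord hwVec
  split_ifs <;> simp_all

theorem component_inclusion_zero (y : N.V) :
    component n a b h N 0 (inclusion n a b h N 0 y) = y := by
  rw [inclusion_apply, component_hwTmul, hwCoord_hwVec_zero, if_pos rfl, one_smul]

theorem sum_hwVec (x : Fin (n + 1) → 𝕜) :
    x = ∑ m ∈ Finset.range (n + 1), hwCoord n m x • hwVec n m := by
  rw [Finset.sum_range]
  funext i
  have hi : ∀ m : Fin (n + 1), hwCoord n m x * hwVec n m i = if i = m then x i else 0 := by
    intro m
    by_cases him : i = m
    · simp [hwCoord, hwVec, him, -Order.lt_add_one_iff]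
    · simp [hwVec, him, Fin.val_inj]
  simp [hi]

theorem sum_inclusion_component (x : (hwTensor n a b h N).V) :
    x = ∑ m ∈ Finset.range (n + 1), inclusion n a b h N m (component n a b h N m x) := by
  have : (LinearMap.id : (hwTensor n a b h N).V →ₗ[𝕜] _) = ∑ m ∈ Finset.range (n + 1),
      inclusion n a b h N m ∘ₗ component n a b h N m := by
    refine hwTensor_ext fun x y => ?_
    simp only [LinearMap.sum_apply, LinearMap.comp_apply, component_hwTmul, inclusion_apply,
      LinearMap.id_apply, map_smul]
    conv_lhs => rw [sum_hwVec n x]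
    simp
  simpa using LinearMap.congr_fun this x

variable {n} in
theorem hwCoord_hwOp {m : ℕ} (hm : m ≤ n) (x : Fin (n + 1) → 𝕜) :
    hwCoord n m (hwOp n a b 0 0 x) = (a - m) * hwCoord n m x ∧
    hwCoord n m (hwOp n a b 1 1 x) = (b + m) * hwCoord n m x ∧
    hwCoord n m (hwOp n a b 0 1 x) = (m + 1) * (a - b - m) * hwCoord n (m + 1) x ∧
    hwCoord n m (hwOp n a b 1 0 x) = (if m = 0 then 0 else 1) * hwCoord n (m - 1) x := by
  have h1 : m < n + 1 := by omega
  have h2 : m - 1 < n + 1 := by omega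
  refine ⟨?_, ?_, ?_, ?_⟩
  · simp [hwCoord, hwOp, h1]
  · simp [hwCoord, hwOp, h1]
  · rcases lt_or_ge m n with h3 | h3
    · simp [hwCoord, hwOp, h1, h3]
    · simp [hwCoord, hwOp, h1, not_lt.2 h3]
  · simp [hwCoord, hwOp, h1, h2]

variable {n} in
theorem hwOp_hwVec {m : ℕ} (hm : m ≤ n) :
    hwOp n a b 0 0 (hwVec n m) = (a - m) • hwVec n m ∧
    hwOp n a b 1 1 (hwVec n m) = (b + m) • hwVec n m ∧
    hwOp n a b 0 1 (hwVec n m) = ((m : 𝕜) * (a - b - m + 1)) • hwVec n (m - 1) ∧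
    hwOp n a b 1 0 (hwVec n m) = hwVec n (m + 1) := by
  refine ⟨?_, ?_, ?_, ?_⟩ <;> funext i <;> obtain ⟨i, hi⟩ := i
  · by_cases h1 : i = m <;> simp [hwOp, hwVec, h1]
  · by_cases h1 : i = m <;> simp [hwOp, hwVec, h1]
  · rcases m with _ | m
    · simp [hwOp, hwVec]
    · by_cases h1 : i = m
      · subst h1
        have h2 : i < n := by omega
        simp only [hwOp, hwVec, LinearMap.coe_mk, AddHom.coe_mk, Pi.smul_apply, smul_eq_mul,
          dif_pos (Nat.succ_lt_succ h2), Nat.add_sub_cancel, if_true]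
        push_cast
        ring
      · simp [hwOp, hwVec, h1]
  · rcases i with _ | i <;> simp [hwOp, hwVec]

/-! ### The induction step for vectors and for functionals -/

variable {n a b h N} {k : ℕ} {α β : Fin (k + 1) → 𝕜}

/-- Here `cₘ = a - m` is the eigenvalue of `e₁₁` on `e₂₁ᵐ ξ`, and `dₘ = (m + 1)(a - b - m)` is the
coefficient in `e₁₂ e₂₁ᵐ⁺¹ ξ = dₘ e₂₁ᵐ ξ`. Thus `hn` says that `e₁₂` kills no `e₂₁ᵐ ξ` with `0 < m ≤
n`. -/
theorem hasUniqueSingular_hwTensor {z : N.V}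
    (hz : HasUniqueSingular k (fun i => β i.succ) (N.op 0 1) (N.op 1 1) z) (hβ : b = β 0)
    (hn : ∀ m < n, ((m : 𝕜) + 1) * (a - b - m) ≠ 0)
    (hne : ∀ m < n, ∀ j : Fin k, a - β j.succ ≠ (m : 𝕜)) :
    HasUniqueSingular (k + 1) β ((hwTensor n a b h N).op 0 1) ((hwTensor n a b h N).op 1 1)
      (inclusion n a b h N 0 z) := by
  refine hz.step n (fun m => a - m) (fun m => b + m) (fun m => (m + 1) * (a - b - m))
    (fun m => if m = 0 then 0 else 1) (component n a b h N) ?_ ?_ ?_ ?_ ?_ ?_ ?_ ?_ ?_ ?_ hn ?_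
  · intro x hx
    rw [sum_inclusion_component n a b h N x]
    simp [hx]
  · intro m hm
    rw [component, hwCoord_of_lt hm]
    simp
    rfl
  · simp [YRep.op_zero]
  · simp [YRep.op_zero]
  · intro m r x hm
    have : component n a b h N m ∘ₗ (hwTensor n a b h N).op 0 1 (r + 1) =
        N.op 0 1 (r + 1) ∘ₗ component n a b h N m
          + (a - m) • N.op 0 1 r ∘ₗ component n a b h N m
          + ((m + 1) * (a - b - m)) • N.op 1 1 r ∘ₗ component n a b h N (m + 1) := by
      refine hwTensor_ext fun x y => ?_
      obtain ⟨h1, -, h3, -⟩ := hwCoord_hwOp a b hm x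
      simp only [LinearMap.add_apply, LinearMap.smul_apply, LinearMap.comp_apply, op_hwTensor,
        map_add, component_hwTmul, h1, h3, map_smul]
      module
    exact LinearMap.congr_fun this x
  · intro m r x hm
    have : component n a b h N m ∘ₗ (hwTensor n a b h N).op 1 1 (r + 1) =
        N.op 1 1 (r + 1) ∘ₗ component n a b h N m
          + (b + m) • N.op 1 1 r ∘ₗ component n a b h N m
          + (if m = 0 then 0 else 1 : 𝕜) • N.op 0 1 r ∘ₗ component n a b h N (m - 1) := by
      refine hwTensor_ext fun x y => ?_
      obtain ⟨-, h2, -, h4⟩ := hwCoord_hwOp a b hm x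
      simp only [LinearMap.add_apply, LinearMap.smul_apply, LinearMap.comp_apply, op_hwTensor,
        map_add, component_hwTmul, h2, h4, map_smul]
      module
    exact LinearMap.congr_fun this x
  · rw [inclusion_apply, component_hwTmul, hwCoord_hwVec_zero]; simp
  · intro m hm
    rw [inclusion_apply, component_hwTmul, hwCoord_hwVec_zero, if_neg (by omega), zero_smul]
  · simp
  · simp [hβ]
  · intro m hm j hj
    exact hne m hm j (by linear_combination -hj)

/-- The mirror image for transposes: the coordinates of a functional are its restrictions to the
subspaces `e₂₁ᵐ ξ ⊗ N`. Since `e₂₁` maps `e₂₁ᵐ ξ` to `e₂₁ᵐ⁺¹ ξ` with coefficient `1`, all `dₘ` are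
`1` and no analogue of `hn` is needed. -/
theorem hasUniqueSingular_dual_hwTensor {f : Module.Dual 𝕜 N.V}
    (hf : HasUniqueSingular k (fun i => α i.succ) (N.dualOp 1 0) (N.dualOp 0 0) f) (hα : a = α 0)
    (hne : ∀ m < n, ∀ j : Fin k, α j.succ - b ≠ (m : 𝕜)) :
    HasUniqueSingular (k + 1) α ((hwTensor n a b h N).dualOp 1 0) ((hwTensor n a b h N).dualOp 0 0)
      (f ∘ₗ component n a b h N 0) := by
  refine hf.step n (fun m => b + m) (fun m => a - m) (fun _ => 1)
    (fun m => (m : 𝕜) * (a - b - m + 1)) (fun m => (inclusion n a b h N m).dualMap)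
    ?_ ?_ ?_ ?_ ?_ ?_ ?_ ?_ ?_ ?_ ?_ ?_
  · intro g hg
    refine LinearMap.ext fun x => ?_
    rw [sum_inclusion_component n a b h N x, map_sum, LinearMap.zero_apply]
    exact Finset.sum_eq_zero fun m _ => LinearMap.congr_fun (hg m) _
  · intro m hm
    refine LinearMap.ext fun g => LinearMap.ext fun y => ?_
    rw [LinearMap.dualMap_apply, inclusion_apply, hwVec_of_lt hm]
    simp
  · refine LinearMap.ext fun g => LinearMap.ext fun y => ?_
    simp [YRep.dualOp_apply, YRep.op_zero]
  · refine LinearMap.ext fun g => LinearMap.ext fun y => ?_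
    simp [YRep.dualOp_apply, YRep.op_zero]
  · intro m r g hm
    refine LinearMap.ext fun y => ?_
    obtain ⟨-, h2, -, h4⟩ := hwOp_hwVec a b hm
    simp only [LinearMap.add_apply, LinearMap.smul_apply, LinearMap.dualMap_apply,
      YRep.dualOp_apply, inclusion_apply, op_hwTensor, map_add, h2, h4, map_smul, smul_eq_mul]
    ring
  · intro m r g hm
    refine LinearMap.ext fun y => ?_
    obtain ⟨h1, -, h3, -⟩ := hwOp_hwVec a b hm
    simp only [LinearMap.add_apply, LinearMap.smul_apply, LinearMap.dualMap_apply,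
      YRep.dualOp_apply, inclusion_apply, op_hwTensor, map_add, h1, h3, map_smul, smul_eq_mul]
    ring
  · refine LinearMap.ext fun y => ?_
    rw [LinearMap.dualMap_apply, LinearMap.comp_apply, inclusion_apply, component_hwTmul,
      hwCoord_hwVec_zero]
    simp
  · intro m hm
    refine LinearMap.ext fun y => ?_
    rw [LinearMap.dualMap_apply, LinearMap.comp_apply, inclusion_apply, component_hwTmul]
    have : hwCoord n 0 (hwVec n m : Fin (n + 1) → 𝕜) = 0 := by
      simp [hwCoord, hwVec, hm.ne]
    simp [this]
  · simp
  · simp [hα]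
  · simp
  · intro m hm j hj
    exact hne m hm j (by linear_combination hj)

theorem hasUniqueSingular_of_span {V : Type u} [AddCommGroup V] [Module 𝕜 V]
    (δ : Fin 0 → 𝕜) {A B : ℕ → Module.End 𝕜 V} {z : V} (hz : z ≠ 0)
    (hspan : ∀ x, ∃ c : 𝕜, x = c • z) (hA : ∀ r, A r = 0) (hB : ∀ r, B r = if r = 0 then 1 else 0) :
    HasUniqueSingular 0 δ A B z where
  A_zero := hA 0
  B_zero := by simp [hB]
  A_of_lt r _ := hA r
  B_of_lt r hr := by rw [hB, if_neg hr.ne']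
  ne_zero := hz
  A_apply r := by simp [hA]
  B_apply r := by rcases r with _ | r <;> simp [hB, elemSymm]
  unique x _ := hspan x
  filtration := by
    -- Since `A = 0`, the two-step filtration `⊥ ≤ ⊤` suffices.
    refine ⟨fun d => if d = 0 then ⊥ else ⊤, ?_, by simp, ⟨1, by simp⟩, ?_, ?_⟩
    · intro d e hde
      rcases Nat.eq_zero_or_pos d with rfl | hd
      · simp
      · simp [hd.ne', (hd.trans_le hde).ne']
    · intro d r x _
      simp [hA]
    · intro d r x hx
      rcases r with _ | r <;> simp [hB, hx]

theorem exists_hasUniqueSingular_trivial (α β : Fin 0 → 𝕜) :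
    ∃ (z : (YRep.trivial 𝕜).V) (f : Module.Dual 𝕜 (YRep.trivial 𝕜).V),
      HasUniqueSingular 0 β ((YRep.trivial 𝕜).op 0 1) ((YRep.trivial 𝕜).op 1 1) z ∧
      HasUniqueSingular 0 α ((YRep.trivial 𝕜).dualOp 1 0) ((YRep.trivial 𝕜).dualOp 0 0) f ∧
      f z = 1 := by
  let e : (YRep.trivial 𝕜).V ≃ₗ[𝕜] 𝕜 := LinearEquiv.refl 𝕜 𝕜
  have he : ∀ x, x = e x • e.symm 1 := fun x => by
    rw [← map_smul, smul_eq_mul, mul_one, e.symm_apply_apply]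
  refine ⟨e.symm 1, e.toLinearMap, ?_, ?_, by simp⟩
  · exact hasUniqueSingular_of_span _ (by simp) (fun x => ⟨e x, he x⟩)
      (fun r => by simp [YRep.op_trivial]) (fun r => by simp [YRep.op_trivial])
  · refine hasUniqueSingular_of_span _ ?_ (fun g => ⟨g (e.symm 1), ?_⟩) (fun r => ?_) (fun r => ?_)
    · intro h0
      simpa using LinearMap.congr_fun h0 (e.symm 1)
    · refine LinearMap.ext fun x => ?_
      conv_lhs => rw [he x]
      simp [mul_comm]
    · refine LinearMap.ext fun g => LinearMap.ext fun x => ?_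
      simp [YRep.dualOp_apply, YRep.op_trivial]
    · refine LinearMap.ext fun g => LinearMap.ext fun x => ?_
      rcases r with _ | r <;> simp [YRep.dualOp_apply, YRep.op_trivial]

/-! ### Irreducibility from the two singular lines -/

theorem YRep.isSimpleModule_of_hasUniqueSingular {k : ℕ} {α β : Fin k → 𝕜} (M : YRep 𝕜) {z : M.V}
    {f : Module.Dual 𝕜 M.V} (hz : HasUniqueSingular k β (M.op 0 1) (M.op 1 1) z)
    (hf : HasUniqueSingular k α (M.dualOp 1 0) (M.dualOp 0 0) f) (hfz : f z ≠ 0) :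
    IsSimpleModule (Yangian 𝕜) M.V := by
  have smul_eq : ∀ (c : 𝕜) (x : M.V), algebraMap 𝕜 (Yangian 𝕜) c • x = c • x := by
    intro c x
    change M.act (algebraMap 𝕜 (Yangian 𝕜) c) x = c • x
    rw [AlgHom.commutes]; rfl
  have hnt : Nontrivial M.V := ⟨z, 0, hz.ne_zero⟩
  refine { toIsSimpleOrder := { eq_bot_or_eq_top := fun P => ?_ } }
  let P' : Submodule 𝕜 M.V :=
    { P.toAddSubmonoid with
      smul_mem' := fun c x hx => by
        have := P.smul_mem (algebraMap 𝕜 (Yangian 𝕜) c) hx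
        rwa [smul_eq] at this }
  have hop : ∀ i j r, ∀ x ∈ P', M.op i j r x ∈ P' := fun i j r x hx => P.smul_mem (yt 𝕜 i j r) hx
  by_cases hP : P' = ⊥
  · left
    refine (Submodule.eq_bot_iff _).2 fun x hx => ?_
    have : x ∈ P' := hx
    rwa [hP, Submodule.mem_bot] at this
  · right
    have hzP : z ∈ P' := hz.mem P' hP fun r x hx => hop 0 1 r x hx
    by_contra hPtop
    have hP' : P' ≠ ⊤ := by
      intro h'
      refine hPtop ((Submodule.eq_top_iff').2 fun x => ?_)
      have : x ∈ P' := h' ▸ Submodule.mem_top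
      exact this
    -- Over a field a proper subspace has a nonzero annihilator, in any dimension.
    have hann : P'.dualAnnihilator ≠ ⊥ := by
      intro h'
      exact hP' (Subspace.dualAnnihilator_inj.1 (h'.trans Submodule.dualAnnihilator_top.symm))
    have hfP := hf.mem P'.dualAnnihilator hann fun r g hg => by
      rw [Submodule.mem_dualAnnihilator] at hg ⊢
      exact fun x hx => hg _ (hop 1 0 r x hx)
    exact hfz ((Submodule.mem_dualAnnihilator f).1 hfP z hzP)

end Representations

/-- Both singular lines are built in one induction so that the normalisation `f z = 1` is carried
along: the new vector is `ξ ⊗ z`, and the new functional is `f` on the `ξ`-component. -/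
theorem exists_hasUniqueSingular {p : ℕ} [Fact p.Prime] {𝕜 : Type u} [Field 𝕜] [CharP 𝕜 p]
    {k : ℕ} (α β : Fin k → ZMod p) (hαβ : WellOrdered α β) :
    ∃ (z : (YRep.tensorFamily k fun i => evalModule 𝕜 (α i) (β i)).V)
      (f : Module.Dual 𝕜 (YRep.tensorFamily k fun i => evalModule 𝕜 (α i) (β i)).V),
      HasUniqueSingular k (fun i => ZMod.castHom (dvd_refl p) 𝕜 (β i))
        ((YRep.tensorFamily k fun i => evalModule 𝕜 (α i) (β i)).op 0 1)
        ((YRep.tensorFamily k fun i => evalModule 𝕜 (α i) (β i)).op 1 1) z ∧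
      HasUniqueSingular k (fun i => ZMod.castHom (dvd_refl p) 𝕜 (α i))
        ((YRep.tensorFamily k fun i => evalModule 𝕜 (α i) (β i)).dualOp 1 0)
        ((YRep.tensorFamily k fun i => evalModule 𝕜 (α i) (β i)).dualOp 0 0) f ∧
      f z = 1 := by
  induction k with
  | zero =>
    obtain ⟨z, f, hz, hf, hfz⟩ := exists_hasUniqueSingular_trivial (𝕜 := 𝕜)
      (fun i => ZMod.castHom (dvd_refl p) 𝕜 (α i)) (fun i => ZMod.castHom (dvd_refl p) 𝕜 (β i))
    exact ⟨z, f, hz, hf, hfz⟩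
  | succ k ih =>
    have hp : p.Prime := Fact.out
    obtain ⟨z, f, hz, hf, hfz⟩ := ih (fun i => α i.succ) (fun i => β i.succ)
      fun i j l hij hil =>
        hαβ i.succ j.succ l.succ (Fin.succ_le_succ_iff.2 hij) (Fin.succ_le_succ_iff.2 hil)
    have hlt : ∀ x : ZMod p, x.val < p := fun x => ZMod.val_lt x
    have hcast : ∀ s t : ℕ, s < p → t < p → (s : 𝕜) = t → s = t := fun s t hs ht hst =>
      Nat.ModEq.eq_of_lt_of_lt ((CharP.natCast_eq_natCast 𝕜 p).1 hst) hs ht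
    -- The only use of the ordering: `[α x - β y]` is at least `[α 0 - β 0] > m`, and distinct
    -- naturals below `p` stay distinct in `𝕜`. It is applied with `x = 0` for vectors and with `y =
    -- 0` for functionals.
    have hab : ∀ (m : ℕ) (x y : Fin (k + 1)), m < (α 0 - β 0).val →
        ZMod.castHom (dvd_refl p) 𝕜 (α x) - ZMod.castHom (dvd_refl p) 𝕜 (β y) ≠ (m : 𝕜) := by
      intro m x y hm he
      rw [val_sub_cast] at he
      have h1 := hcast _ _ (hlt _) (hm.trans (hlt _)) he
      have h2 := hαβ 0 x y (Fin.zero_le _) (Fin.zero_le _)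
      omega
    have h := val_sub_cast (𝕜 := 𝕜) (α 0) (β 0)
    refine ⟨inclusion _ _ _ h _ 0 z, f ∘ₗ component _ _ _ h _ 0, ?_, ?_, ?_⟩
    · refine hasUniqueSingular_hwTensor hz rfl (fun m hm => mul_ne_zero ?_ ?_)
        (fun m hm j => hab m 0 j.succ hm)
      · intro h0
        have := hcast (m + 1) 0 (by have := hlt (α 0 - β 0); omega) hp.pos (by simpa using h0)
        omega
      · exact sub_ne_zero.2 (hab m 0 0 hm)
    · exact hasUniqueSingular_dual_hwTensor hf rfl (fun m hm j => hab m j.succ 0 hm)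
    · exact (congrArg f (component_inclusion_zero ..)).trans hfz

end ModularYangian

open ModularYangian in
theorem proposition2p9 {p : ℕ} [Fact p.Prime] {𝕜 : Type u} [Field 𝕜] [IsAlgClosed 𝕜] [CharP 𝕜 p]
    {k : ℕ} (α β : Fin k → ZMod p) :
    (∃ σ τ : Equiv.Perm (Fin k), WellOrdered (α ∘ σ) (β ∘ τ)) ∧
    ∀ σ τ : Equiv.Perm (Fin k), WellOrdered (α ∘ σ) (β ∘ τ) →
      IsSimpleModule (Yangian 𝕜)
        (YRep.tensorFamily k fun i => evalModule 𝕜 (α (σ i)) (β (τ i))).V := by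
  refine ⟨exists_wellOrdered α β, fun σ τ hστ => ?_⟩
  obtain ⟨z, f, hz, hf, hfz⟩ := exists_hasUniqueSingular (𝕜 := 𝕜) (α ∘ σ) (β ∘ τ) hστ
  exact YRep.isSimpleModule_of_hasUniqueSingular _ hz hf (hfz ▸ one_ne_zero)
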